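/- A variety in $\mathbb{C}^n$ is the zero locus of finitely many polynomials in $n$ complex variables; its dimension is the Krull dimension of its coordinate ring, and the empty variety has dimension $-\infty$. A variety $V\subset\mathbb{C}^d$ is called admissible with respect to a set $F$ of linear functions $\mathbb{C}^d\to\mathbb{C}$ if $\dim(V\cap\{a:\ell(a)=0\})<\dim V$ for every $\ell\in F$. Let $L:\mathbb{C}^d\times\mathbb{C}^d\to\mathbb{C}$ be bilinear, let $W\subset\mathbb{C}^d$ be the zero locus of finitely many homogeneous polynomials, and let $V_1,\dots,V_m\subset\mathbb{C}^d$ be varieties, each of which is admissible with respect to the set of linear functions $\{L(\cdot,x): x\in W\setminus\{0\}\}$. Put $V:=V_1\times\cdots\times V_m\subset(\mathbb{C}^d)^m$ and, for $A=(a_1,\dots,a_m)\in V$, $L_A(x):=(L(a_1,x),\dots,L(a_m,x))\in\mathbb{C}^m$. Then the following hold. (i) If $m\ge\dim W$, then there is a variety $Z\subset V$ with $\dim Z\le\dim V-\delta$, where $\delta:=m-\dim W+1$, such that for all $A\in V\setminus Z$ and all $x\in W$, $L_A(x)=0$ implies $x=0$. (If $W=\emptyset$, the dimension bound is read as $Z=\emptyset$.)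 (ii) If $m<\dim W$, then for every $A\in V$ there is a nonzero $x_0\in W$ with $L_A(x_0)=0$. Consequently, if $V\neq\emptyset$, there exists $A\in V$ such that $L_A(x)=0$, $x\in W$, forces $x=0$ if and only if $m\ge\dim W$; that is, $\dim W$ is the exact minimal number of measurements. -/

import Mathlib

/-- The zero locus in `ℂ^σ` of a finite collection of complex polynomials. -/
def IsAlgebraicVariety {σ : Type*} (W : Set (σ → ℂ)) : Prop :=
  ∃ S : Finset (MvPolynomial σ ℂ), W = {x | ∀ p ∈ S, MvPolynomial.eval x p = 0}

/-- The zero locus in `ℂ^σ` of a finite collection of homogeneous complex polynomials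
(of possibly different degrees). -/
def IsHomogeneousVariety {σ : Type*} (W : Set (σ → ℂ)) : Prop :=
  ∃ S : Finset (MvPolynomial σ ℂ), (∀ p ∈ S, ∃ n : ℕ, p.IsHomogeneous n) ∧
    W = {x | ∀ p ∈ S, MvPolynomial.eval x p = 0}

/-- The dimension of an affine variety `W ⊆ ℂ^σ`: the Krull dimension of its coordinate ring
`ℂ[x] / I(W)`. The empty variety has dimension `⊥`. -/
noncomputable def varietyDim {σ : Type*} (W : Set (σ → ℂ)) : WithBot ℕ∞ :=
  ringKrullDim (MvPolynomial σ ℂ ⧸ MvPolynomial.vanishingIdeal ℂ W)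

/-- `V` is admissible with respect to a set of linear functions if cutting it with the kernel of
any of them lowers the dimension. -/
def IsAdmissible {σ : Type*} (V : Set (σ → ℂ)) (F : Set ((σ → ℂ) →ₗ[ℂ] ℂ)) : Prop :=
  ∀ l ∈ F, varietyDim (V ∩ {a | l a = 0}) < varietyDim V

/-- The product `V₁ × ⋯ × V_m ⊆ (ℂ^d)^m`; the `j`-th component of `A ∈ ℂ^{m × d}` is its
`j`-th row `i ↦ A (j, i)`. -/
def productVariety {m d : ℕ} (V : Fin m → Set (Fin d → ℂ)) : Set (Fin m × Fin d → ℂ) :=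
  {A | ∀ j, (fun i => A (j, i)) ∈ V j}

/-- The linear samples `L_A(x) = (L(a₁, x), …, L(a_m, x))`, with `a_j` the `j`-th row of `A`. -/
def linearSamples {m d : ℕ} (L : (Fin d → ℂ) →ₗ[ℂ] (Fin d → ℂ) →ₗ[ℂ] ℂ)
    (A : Fin m × Fin d → ℂ) (x : Fin d → ℂ) : Fin m → ℂ :=
  fun j => L (fun i => A (j, i)) x

/-!
Let `E` be the set of pairs `(A, x)` with `A` in the product of the `V j`, `x ∈ W` and
`L_A(x) = 0`. Each of the `m` factors of its fibre over `x ≠ 0` is a hyperplane section that drops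
in dimension by admissibility, so that fibre has dimension at most `dim V - m`. Samples do not
detect the scale of `x`, so one may normalise some coordinate `x i = 1`, which lowers the dimension
of the cone `W` by one. The projection to `A` of the normalised part of `E` thus has dimension at
most `dim V - m + dim W - 1`, and it consists of the bad `A`.

Conversely, if `L_A` vanishes on `W` only at the origin, then by the Nullstellensatz and graded
Nakayama the coordinate ring of `W` is finite over the polynomial ring in the `m` forms
`L(a_j, ·)`, hence `dim W ≤ m`.
-/

open MvPolynomial

/-! ### Krull dimension -/

section KrullDimension

theorem withBot_add_one_le_of_lt {α : Type*} [Preorder α] [Add α] [One α] [SuccAddOrder α]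
    {a b : WithBot α} (h : a < b) : a + 1 ≤ b := by
  induction a with
  | bot => simp
  | coe a =>
    induction b with
    | bot => exact absurd h not_lt_bot
    | coe b => exact WithBot.coe_le_coe.mpr (Order.add_one_le_of_lt (WithBot.coe_lt_coe.mp h))

theorem ringKrullDim_le_of_isIntegral {R S : Type*} [CommRing R] [CommRing S] (f : R →+* S)
    (hf : f.IsIntegral) : ringKrullDim S ≤ ringKrullDim R := by
  algebraize [f]
  exact Order.krullDim_le_of_strictMono (PrimeSpectrum.comap f) fun _ _ hpq =>
    Ideal.IsIntegral.comap_lt_comap (R := R) (A := S) hpq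

theorem ringKrullDim_eq_of_isIntegral {R S : Type*} [CommRing R] [CommRing S] (f : R →+* S)
    (hf : f.IsIntegral) (hinj : Function.Injective f) : ringKrullDim S = ringKrullDim R := by
  refine le_antisymm (ringKrullDim_le_of_isIntegral f hf) ?_
  algebraize [f]
  have : FaithfulSMul R S := (faithfulSMul_iff_algebraMap_injective R S).mpr hinj
  refine iSup_le fun l => ?_
  obtain ⟨⟨P, hP, hPl⟩⟩ := Ideal.nonempty_primesOver (S := S) l.head.asIdeal
  obtain ⟨l', hl', -⟩ := Ideal.exists_ltSeries_of_hasGoingUp (S := S) l P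
  exact hl' ▸ Order.LTSeries.length_le_krullDim l'

theorem ringKrullDim_quotient_radical {R : Type*} [CommRing R] (I : Ideal R) :
    ringKrullDim (R ⧸ I.radical) = ringKrullDim (R ⧸ I) := by
  rw [ringKrullDim_quotient, ringKrullDim_quotient, PrimeSpectrum.zeroLocus_radical]

theorem ringKrullDim_quotient_anti {R : Type*} [CommRing R] {I J : Ideal R} (h : I ≤ J) :
    ringKrullDim (R ⧸ J) ≤ ringKrullDim (R ⧸ I) :=
  ringKrullDim_le_of_surjective _ (Ideal.Quotient.factor_surjective h)

theorem ringKrullDim_quotient_iInf {R ι : Type*} [CommRing R] [Finite ι] (I : ι → Ideal R) :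
    ringKrullDim (R ⧸ ⨅ i, I i) = ⨆ i, ringKrullDim (R ⧸ I i) := by
  refine le_antisymm ?_ (iSup_le fun i => ringKrullDim_quotient_anti (iInf_le I i))
  cases nonempty_fintype ι
  rw [ringKrullDim_quotient]
  refine iSup_le fun l => ?_
  obtain ⟨i, hi⟩ : ∃ i, I i ≤ l.head.1.asIdeal := by
    simpa [Finset.inf_univ_eq_iInf, show ⨅ i, I i ≤ l.head.1.asIdeal from l.head.2] using
      l.head.1.isPrime.inf_le' (s := Finset.univ) (f := I)
  let chain : LTSeries (PrimeSpectrum.zeroLocus (I i : Set R)) :=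
    LTSeries.mk l.length (fun k => ⟨(l k).1, hi.trans (LTSeries.head_le l k)⟩)
      fun _ _ hjk => l.strictMono hjk
  calc (l.length : WithBot ℕ∞)
      ≤ ringKrullDim (R ⧸ I i) := by
        rw [ringKrullDim_quotient]
        exact Order.LTSeries.length_le_krullDim chain
    _ ≤ ⨆ i, ringKrullDim (R ⧸ I i) := le_iSup (fun i => ringKrullDim (R ⧸ I i)) i

theorem exists_isMaximal_ringKrullDim_le_add_quotient_map_under (R S : Type*) [CommRing R]
    [CommRing S] [Algebra R S] [IsNoetherianRing R] [IsNoetherianRing S] [FiniteRingKrullDim S] :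
    ∃ M : Ideal S, M.IsMaximal ∧ ringKrullDim S ≤
      ringKrullDim R + ringKrullDim (S ⧸ (M.under R).map (algebraMap R S)) := by
  obtain ⟨M, hM, hMdim⟩ := Ideal.exists_isMaximal_height (R := S)
  set J := (M.under R).map (algebraMap R S)
  have hJM : J ≤ M := Ideal.map_comap_le
  have hMJ : M.map (Ideal.Quotient.mk J) ≠ ⊤ := fun htop => hM.ne_top <| by
    rw [← Ideal.comap_map_mk hJM, htop, Ideal.comap_top]
  refine ⟨M, hM, ?_⟩
  calc ringKrullDim S
      = (M.height : WithBot ℕ∞) := hMdim.symm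
    _ ≤ ((M.under R).height : WithBot ℕ∞) + (M.map (Ideal.Quotient.mk J)).height := by
        exact_mod_cast Ideal.height_le_height_add_of_liesOver (M.under R) M
    _ ≤ ringKrullDim R + ringKrullDim (S ⧸ J) :=
        add_le_add (Ideal.height_le_ringKrullDim_of_ne_top (Ideal.IsPrime.ne_top inferInstance))
          (Ideal.height_le_ringKrullDim_of_ne_top hMJ)

variable {k A B : Type*} [Field k] [CommRing A] [CommRing B] [Algebra k A] [Algebra k B]

theorem ringKrullDim_mvPolynomial_eq_card (k σ : Type*) [Field k] [Finite σ] :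
    ringKrullDim (MvPolynomial σ k) = Nat.card σ := by
  simp [ringKrullDim_of_isNoetherianRing]

theorem ringKrullDim_eq_card_of_isIntegral {s : Type*} [Finite s] (g : MvPolynomial s k →ₐ[k] A)
    (hinj : Function.Injective g) (hint : g.IsIntegral) : ringKrullDim A = Nat.card s :=
  (ringKrullDim_eq_of_isIntegral g.toRingHom hint hinj).trans
    (ringKrullDim_mvPolynomial_eq_card k s)

theorem finiteRingKrullDim_of_finiteType (k A : Type*) [Field k] [CommRing A] [Nontrivial A]
    [Algebra k A] [Algebra.FiniteType k A] : FiniteRingKrullDim A := by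
  obtain ⟨s, g, hinj, hint⟩ := exists_integral_inj_algHom_of_fg k A
  rw [finiteRingKrullDim_iff_ne_bot_and_top, ringKrullDim_eq_card_of_isIntegral g hinj hint]
  exact ⟨WithBot.natCast_ne_bot _, WithBot.coe_injective.ne (ENat.natCast_ne_top _)⟩

theorem ringKrullDim_eq_toENat_trdeg (k A : Type*) [Field k] [CommRing A] [IsDomain A]
    [Algebra k A] [Algebra.FiniteType k A] :
    ringKrullDim A = (Cardinal.toENat (Algebra.trdeg k A) : ℕ∞) := by
  obtain ⟨s, g, hinj, hint⟩ := exists_integral_inj_algHom_of_fg k A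
  have htrdeg : Algebra.trdeg k A = s := by
    algebraize [g.toRingHom]
    have : IsScalarTower k (MvPolynomial (Fin s) k) A := .of_algHom g
    have : FaithfulSMul (MvPolynomial (Fin s) k) A :=
      (faithfulSMul_iff_algebraMap_injective _ _).mpr hinj
    have := ((IsTranscendenceBasis.mvPolynomial (Fin s) k).algebraMap_comp
      (A := A)).lift_cardinalMk_eq_trdeg
    simpa using this.symm
  rw [ringKrullDim_eq_card_of_isIntegral g hinj hint, htrdeg]
  simp

theorem ringKrullDim_le_of_injective [Algebra.FiniteType k A] [Algebra.FiniteType k B]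
    (f : A →ₐ[k] B) (hf : Function.Injective f) : ringKrullDim A ≤ ringKrullDim B := by
  cases subsingleton_or_nontrivial A
  · simp [ringKrullDim_eq_bot_of_subsingleton]
  obtain ⟨s, g, hinj, hint⟩ := exists_integral_inj_algHom_of_fg k A
  obtain ⟨q, hq, hqcomap⟩ := Ideal.exists_comap_eq_of_mem_minimalPrimes_of_injective
    (f := (f.comp g).toRingHom) (hf.comp hinj) ⊥ (by simp [IsDomain.minimalPrimes_eq_singleton_bot])
  let h : MvPolynomial (Fin s) k →ₐ[k] B ⧸ q := (Ideal.Quotient.mkₐ k q).comp (f.comp g)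
  have hh : Function.Injective h := by
    refine (injective_iff_map_eq_zero h).mpr fun p hp => ?_
    rw [← Ideal.mem_bot, ← hqcomap]
    exact Ideal.mem_comap.mpr ((Ideal.Quotient.eq_zero_iff_mem (I := q)).mp hp)
  calc ringKrullDim A
      = ringKrullDim (MvPolynomial (Fin s) k) := ringKrullDim_eq_of_isIntegral g.toRingHom hint hinj
    _ ≤ ringKrullDim (B ⧸ q) := by
        rw [ringKrullDim_eq_toENat_trdeg k, ringKrullDim_eq_toENat_trdeg k (B ⧸ q),
          WithBot.coe_le_coe]
        simpa using Cardinal.toENat.monotone' (lift_trdeg_le_of_injective h hh)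
    _ ≤ ringKrullDim B := ringKrullDim_quotient_le q

end KrullDimension

/-! ### Zariski closed sets and their dimension -/

section ZariskiClosed

variable {K σ τ ι : Type*} [Field K]

/-- Zariski closed subsets of the affine space `K^σ`: common zeros of an arbitrary set of
polynomials. -/
def IsZariskiClosed (V : Set (σ → K)) : Prop :=
  ∃ S : Set (MvPolynomial σ K), V = {x | ∀ p ∈ S, eval x p = 0}

/-- The coordinate ring of the Zariski closure of a set of points. -/
abbrev CoordinateRing (V : Set (σ → K)) : Type _ :=
  MvPolynomial σ K ⧸ vanishingIdeal K V

/-- The dimension of the Zariski closure of a set of points of affine space; it is `⊥` for the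
empty set. -/
noncomputable def zariskiDim (V : Set (σ → K)) : WithBot ℕ∞ :=
  ringKrullDim (MvPolynomial σ K ⧸ vanishingIdeal K V)

/-- Maps between affine spaces whose coordinates are polynomials. -/
def IsPolynomialMap (φ : (σ → K) → τ → K) : Prop :=
  ∃ f : τ → MvPolynomial σ K, φ = fun x i => eval x (f i)

theorem isPolynomialMap_comp_right (e : τ → σ) : IsPolynomialMap fun x : σ → K => x ∘ e :=
  ⟨fun i => X (e i), by ext; simp⟩

theorem isPolynomialMap_sumElim (y : τ → K) : IsPolynomialMap fun x : σ → K => Sum.elim x y :=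
  ⟨Sum.elim X (C ∘ y), by ext x (i | i) <;> simp⟩

theorem eval_bind₁ (f : τ → MvPolynomial σ K) (p : MvPolynomial τ K) (x : σ → K) :
    eval x (bind₁ f p) = eval (fun i => eval x (f i)) p := by
  simp only [← aeval_eq_eval, aeval_bind₁]

theorem isZariskiClosed_zeroLocus (I : Ideal (MvPolynomial σ K)) :
    IsZariskiClosed (zeroLocus K I) :=
  ⟨I, by ext; simp [aeval_eq_eval]⟩

theorem IsZariskiClosed.zeroLocus_vanishingIdeal {V : Set (σ → K)} (hV : IsZariskiClosed V) :
    zeroLocus K (vanishingIdeal K V) = V := by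
  refine Set.Subset.antisymm ?_ (zeroLocus_vanishingIdeal_le V)
  obtain ⟨S, rfl⟩ := hV
  exact fun x hx p hp => hx p fun y hy => hy p hp

theorem isZariskiClosed_setOf_eval_eq_zero (p : MvPolynomial σ K) :
    IsZariskiClosed {x | eval x p = 0} :=
  ⟨{p}, by simp⟩

theorem isZariskiClosed_setOf_coord_eq (i : σ) (c : K) : IsZariskiClosed {x | x i = c} :=
  ⟨{X i - C c}, by simp [sub_eq_zero]⟩

theorem IsZariskiClosed.iInter {V : ι → Set (σ → K)} (hV : ∀ i, IsZariskiClosed (V i)) :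
    IsZariskiClosed (⋂ i, V i) := by
  choose S hS using hV
  refine ⟨⋃ i, S i, ?_⟩
  ext x
  simp only [hS, Set.mem_iInter, Set.mem_ofPred_eq, Set.mem_iUnion, forall_exists_index]
  exact forall_comm

theorem IsZariskiClosed.inter {V W : Set (σ → K)} (hV : IsZariskiClosed V)
    (hW : IsZariskiClosed W) : IsZariskiClosed (V ∩ W) := by
  rw [Set.inter_eq_iInter]
  exact .iInter <| by simp [hV, hW]

theorem IsZariskiClosed.preimage {V : Set (τ → K)} (hV : IsZariskiClosed V)
    {φ : (σ → K) → τ → K} (hφ : IsPolynomialMap φ) : IsZariskiClosed (φ ⁻¹' V) := by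
  obtain ⟨S, rfl⟩ := hV
  obtain ⟨f, rfl⟩ := hφ
  exact ⟨bind₁ f '' S, by ext; simp [eval_bind₁]⟩

@[simp]
theorem zariskiDim_empty : zariskiDim (∅ : Set (σ → K)) = ⊥ := by
  rw [zariskiDim, vanishingIdeal_empty]
  exact ringKrullDim_eq_bot_of_subsingleton

theorem nontrivial_coordinateRing {V : Set (σ → K)} (hV : V.Nonempty) :
    Nontrivial (CoordinateRing V) := by
  obtain ⟨x, hx⟩ := hV
  refine Ideal.Quotient.nontrivial_iff.mpr ((Ideal.ne_top_iff_one _).mpr fun h => ?_)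
  simpa using h x hx

theorem zariskiDim_mono {V W : Set (σ → K)} (h : V ⊆ W) : zariskiDim V ≤ zariskiDim W :=
  ringKrullDim_quotient_anti (vanishingIdeal_anti_mono h)

theorem zariskiDim_zeroLocus_vanishingIdeal (V : Set (σ → K)) :
    zariskiDim (zeroLocus K (vanishingIdeal K V)) = zariskiDim V := by
  have h := zeroLocus_vanishingIdeal_galoisConnection (k := K) (K := K) |>.u_l_u_eq_u (.toDual V)
  rw [zariskiDim, zariskiDim]
  exact congr_arg (fun I => ringKrullDim (MvPolynomial σ K ⧸ I)) h

theorem zariskiDim_image_le [Finite σ] [Finite τ] {φ : (σ → K) → τ → K} (hφ : IsPolynomialMap φ)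
    (V : Set (σ → K)) : zariskiDim (φ '' V) ≤ zariskiDim V := by
  obtain ⟨f, rfl⟩ := hφ
  have hcomap : vanishingIdeal K ((fun x i => eval x (f i)) '' V) =
      (vanishingIdeal K V).comap (bind₁ f) := by
    ext p
    simp [aeval_eq_eval, eval_bind₁]
  exact ringKrullDim_le_of_injective (Ideal.quotientMapₐ _ (bind₁ f) hcomap.le)
    (Ideal.quotientMap_injective' (H := hcomap.le) hcomap.ge)

theorem zariskiDim_iUnion [Finite ι] (V : ι → Set (σ → K)) :
    zariskiDim (⋃ i, V i) = ⨆ i, zariskiDim (V i) := by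
  have h : vanishingIdeal K (⋃ i, V i) = ⨅ i, vanishingIdeal K (V i) := by
    ext p
    simp only [mem_vanishingIdeal_iff, Set.mem_iUnion, Ideal.mem_iInf, forall_exists_index]
    exact forall_comm
  rw [zariskiDim, h]
  exact ringKrullDim_quotient_iInf _

theorem zariskiDim_iUnion_add_le [Finite ι] {V : ι → Set (σ → K)}
    {n D : WithBot ℕ∞} (h : ∀ i, zariskiDim (V i) + n ≤ D) : zariskiDim (⋃ i, V i) + n ≤ D := by
  cases isEmpty_or_nonempty ι
  · simp
  · obtain ⟨i, hi⟩ := exists_eq_ciSup_of_finite (f := fun i => zariskiDim (V i))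
    rw [zariskiDim_iUnion, ← hi]
    exact h i

theorem exists_zariskiDim_eq_natCast [Finite σ] {V : Set (σ → K)} (hV : V.Nonempty) :
    ∃ n : ℕ, zariskiDim V = n := by
  have := nontrivial_coordinateRing hV
  obtain ⟨s, g, hinj, hint⟩ := exists_integral_inj_algHom_of_fg K (CoordinateRing V)
  exact ⟨s, by simpa [zariskiDim] using ringKrullDim_eq_card_of_isIntegral g hinj hint⟩

/-- Evaluation at a point of `V`, as a `K`-point of the coordinate ring. -/
noncomputable def evalAt {V : Set (σ → K)} {a : σ → K} (ha : a ∈ V) : CoordinateRing V →ₐ[K] K :=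
  Ideal.Quotient.liftₐ _ (aeval a) fun _ hp => hp a ha

@[simp]
theorem evalAt_mk {V : Set (σ → K)} {a : σ → K} (ha : a ∈ V) (p : MvPolynomial σ K) :
    evalAt ha (Ideal.Quotient.mk _ p) = eval a p := by
  simp [evalAt]

variable [IsAlgClosed K] [Finite σ]

theorem zariskiDim_zeroLocus (I : Ideal (MvPolynomial σ K)) :
    zariskiDim (zeroLocus K I) = ringKrullDim (MvPolynomial σ K ⧸ I) := by
  rw [zariskiDim, vanishingIdeal_zeroLocus_eq_radical, ringKrullDim_quotient_radical]

theorem zariskiDim_zeroLocus_ker {B : Type*} [CommRing B] [Algebra K B]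
    (π : MvPolynomial σ K →ₐ[K] B) (hπ : Function.Surjective π) :
    zariskiDim (zeroLocus K (RingHom.ker π)) = ringKrullDim B :=
  (zariskiDim_zeroLocus _).trans <|
    ringKrullDim_eq_of_ringEquiv (Ideal.quotientKerAlgEquivOfSurjective hπ).toRingEquiv

theorem IsZariskiClosed.exists_eq_ker_evalAt {V : Set (σ → K)} (hV : IsZariskiClosed V)
    (M : Ideal (CoordinateRing V)) [M.IsMaximal] :
    ∃ (a : σ → K) (ha : a ∈ V), M = RingHom.ker (evalAt ha) := by
  have := Ideal.comap_isMaximal_of_surjective (Ideal.Quotient.mk (vanishingIdeal K V))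
    Ideal.Quotient.mk_surjective (K := M)
  obtain ⟨a, ha⟩ := eq_vanishingIdeal_singleton_of_isMaximal K this
  have haV : a ∈ V := by
    rw [← hV.zeroLocus_vanishingIdeal]
    intro p hp
    rw [← mem_vanishingIdeal_singleton_iff, ← ha, Ideal.mem_comap,
      Ideal.Quotient.eq_zero_iff_mem.mpr hp]
    exact M.zero_mem
  refine ⟨a, haV, ?_⟩
  ext b
  obtain ⟨p, rfl⟩ := Ideal.Quotient.mk_surjective b
  rw [← Ideal.mem_comap, ha, mem_vanishingIdeal_singleton_iff, RingHom.mem_ker, evalAt_mk,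
    aeval_eq_eval]

theorem IsZariskiClosed.exists_evalAt_comp_eq_aeval {V : Set (σ → K)} (hV : IsZariskiClosed V)
    (g : MvPolynomial τ K →ₐ[K] CoordinateRing V) (hinj : Function.Injective g)
    (hint : g.IsIntegral) (u : τ → K) :
    ∃ (a : σ → K) (ha : a ∈ V), (evalAt ha).comp g = aeval u := by
  obtain ⟨Q, hQ, hQu⟩ : ∃ Q : Ideal (CoordinateRing V),
      Q.IsMaximal ∧ Q.comap g.toRingHom = vanishingIdeal K {u} := by
    algebraize [g.toRingHom]
    exact Ideal.exists_ideal_over_maximal_of_isIntegral (vanishingIdeal K {u})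
      ((RingHom.injective_iff_ker_eq_bot _).mp hinj ▸ bot_le)
  obtain ⟨a, ha, rfl⟩ := hV.exists_eq_ker_evalAt Q
  refine ⟨a, ha, AlgHom.ext fun p => ?_⟩
  have hp : p - C (eval u p) ∈ vanishingIdeal K {u} := by
    simp [aeval_eq_eval]
  rw [← hQu, Ideal.mem_comap, RingHom.mem_ker] at hp
  have hC (c : K) : evalAt ha (g (C c)) = c := by
    simp
  simpa [hC, sub_eq_zero, aeval_eq_eval] using hp

end ZariskiClosed

/-! ### Products and fibres -/

section ProductsAndFibres

variable {K σ τ ι : Type*}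

/-- The product of a family of subsets of `K^σ`, as a subset of `K^(ι × σ)`: a point `A` is read
as the matrix with rows `A (j, ·)`. -/
def affineProduct (V : ι → Set (σ → K)) : Set (ι × σ → K) :=
  {A | ∀ j, A ∘ Prod.mk j ∈ V j}

theorem mapsTo_comp_prodMk_affineProduct (V : ι → Set (σ → K)) (j : ι) :
    Set.MapsTo (· ∘ Prod.mk j) (affineProduct V) (V j) := fun _ hA => hA j

variable [Field K]

/-- The map of coordinate rings induced by a coordinate projection sending `V` into `W`. -/
noncomputable def coordinateRingMap (e : τ → σ) {V : Set (σ → K)} {W : Set (τ → K)}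
    (h : Set.MapsTo (· ∘ e) V W) : CoordinateRing W →ₐ[K] CoordinateRing V :=
  Ideal.quotientMapₐ _ (rename e) fun p hp x hx => by simpa [aeval_rename] using hp _ (h hx)

@[simp]
theorem coordinateRingMap_mk (e : τ → σ) {V : Set (σ → K)} {W : Set (τ → K)}
    (h : Set.MapsTo (· ∘ e) V W) (p : MvPolynomial τ K) :
    coordinateRingMap e h (Ideal.Quotient.mk _ p) = Ideal.Quotient.mk _ (rename e p) := rfl

@[simp]
theorem evalAt_coordinateRingMap (e : τ → σ) {V : Set (σ → K)} {W : Set (τ → K)}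
    (h : Set.MapsTo (· ∘ e) V W) {x : σ → K} (hx : x ∈ V) (b : CoordinateRing W) :
    evalAt hx (coordinateRingMap e h b) = evalAt (h hx) b := by
  obtain ⟨p, rfl⟩ := Ideal.Quotient.mk_surjective b
  simp [eval_rename]

theorem isZariskiClosed_affineProduct {V : ι → Set (σ → K)} (hV : ∀ j, IsZariskiClosed (V j)) :
    IsZariskiClosed (affineProduct V) := by
  rw [affineProduct, Set.ofPred_forall]
  exact .iInter fun j => (hV j).preimage (isPolynomialMap_comp_right (Prod.mk j))

/-- Parametrisations of the factors of a product by polynomial rings, combined into one of the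
product. -/
noncomputable def affineProductHom {V : ι → Set (σ → K)} {s : ι → Type*}
    (g : ∀ j, MvPolynomial (s j) K →ₐ[K] CoordinateRing (V j)) :
    MvPolynomial (Σ j, s j) K →ₐ[K] CoordinateRing (affineProduct V) :=
  aeval fun t => coordinateRingMap _ (mapsTo_comp_prodMk_affineProduct V t.1) (g t.1 (X t.2))

theorem affineProductHom_isIntegral {V : ι → Set (σ → K)} {s : ι → Type*}
    {g : ∀ j, MvPolynomial (s j) K →ₐ[K] CoordinateRing (V j)} (hint : ∀ j, (g j).IsIntegral) :
    (affineProductHom g).IsIntegral := by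
  have hX (j : ι) (i : σ) : (affineProductHom g).toRingHom.IsIntegralElem
      (Ideal.Quotient.mk (vanishingIdeal K (affineProduct V)) (X (j, i))) := by
    let ρ := coordinateRingMap _ (mapsTo_comp_prodMk_affineProduct V j)
    have hcomp : (affineProductHom g).comp (rename (Sigma.mk j)) = ρ.comp (g j) := by
      ext i
      simp [affineProductHom, ρ]
    refine RingHom.IsIntegralElem.of_comp (f := (rename (Sigma.mk j)).toRingHom) ?_
    have hρ : (ρ.toRingHom.comp (g j).toRingHom).IsIntegralElem
        (ρ.toRingHom (Ideal.Quotient.mk _ (X i))) :=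
      (hint j (Ideal.Quotient.mk _ (X i))).map ρ.toRingHom
    convert hρ using 1
    · exact congr_arg AlgHom.toRingHom hcomp
    · simp [ρ]
  intro b
  obtain ⟨p, rfl⟩ := Ideal.Quotient.mk_surjective b
  induction p using MvPolynomial.induction_on with
  | C c =>
    have hc : (affineProductHom g).toRingHom (C c) = Ideal.Quotient.mk _ (C c) :=
      (affineProductHom g).commutes c
    exact hc ▸ RingHom.isIntegralElem_map _
  | add p q hp hq =>
    rw [map_add]
    exact hp.add _ hq
  | mul_X p t hp =>
    rw [map_mul]
    exact hp.mul _ (hX t.1 t.2)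

variable [IsAlgClosed K] [Finite σ]

theorem affineProductHom_injective {V : ι → Set (σ → K)} (hV : ∀ j, IsZariskiClosed (V j))
    {s : ι → Type*} {g : ∀ j, MvPolynomial (s j) K →ₐ[K] CoordinateRing (V j)}
    (hinj : ∀ j, Function.Injective (g j)) (hint : ∀ j, (g j).IsIntegral) :
    Function.Injective (affineProductHom g) := by
  refine (injective_iff_map_eq_zero _).mpr fun p hp => MvPolynomial.funext fun u => ?_
  choose a ha hau using fun j =>
    (hV j).exists_evalAt_comp_eq_aeval (g j) (hinj j) (hint j) fun i => u ⟨j, i⟩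
  have hA : (fun t : ι × σ => a t.1 t.2) ∈ affineProduct V := ha
  have hcomp : (evalAt hA).comp (affineProductHom g) = aeval u := by
    ext ⟨j, i⟩
    simpa [affineProductHom] using DFunLike.congr_fun (hau j) (X i)
  rw [map_zero, ← aeval_eq_eval, ← hcomp, AlgHom.comp_apply, hp, map_zero]

theorem zariskiDim_affineProduct [Fintype ι] {V : ι → Set (σ → K)}
    (hV : ∀ j, IsZariskiClosed (V j)) :
    zariskiDim (affineProduct V) = ∑ j, zariskiDim (V j) := by
  by_cases hempty : ∃ j, V j = ∅
  · obtain ⟨j, hj⟩ := hempty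
    have hprod : affineProduct V = ∅ := Set.eq_empty_of_forall_notMem fun A hA => by
      simpa [hj] using hA j
    rw [hprod, zariskiDim_empty, eq_comm, WithBot.sum_eq_bot_iff]
    exact ⟨j, Finset.mem_univ j, by rw [hj, zariskiDim_empty]⟩
  push Not at hempty
  have (j : ι) := nontrivial_coordinateRing (hempty j)
  choose s g hinj hint using fun j => exists_integral_inj_algHom_of_fg K (CoordinateRing (V j))
  have hdim (j : ι) : zariskiDim (V j) = s j := by
    simpa [zariskiDim] using ringKrullDim_eq_card_of_isIntegral (g j) (hinj j) (hint j)
  calc zariskiDim (affineProduct V)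
      = Nat.card (Σ j, Fin (s j)) := ringKrullDim_eq_card_of_isIntegral (affineProductHom g)
        (affineProductHom_injective hV hinj hint) (affineProductHom_isIntegral hint)
    _ = ∑ j, zariskiDim (V j) := by simp [hdim]

theorem zariskiDim_affineProduct_add_card_le [Fintype ι] {V V' : ι → Set (σ → K)}
    (hV : ∀ j, IsZariskiClosed (V j)) (hV' : ∀ j, IsZariskiClosed (V' j))
    (hlt : ∀ j, zariskiDim (V' j) < zariskiDim (V j)) :
    zariskiDim (affineProduct V') + Fintype.card ι ≤ zariskiDim (affineProduct V) := by
  rw [zariskiDim_affineProduct hV, zariskiDim_affineProduct hV']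
  calc ∑ j, zariskiDim (V' j) + (Fintype.card ι : WithBot ℕ∞)
      = ∑ j, (zariskiDim (V' j) + 1) := by simp [Finset.sum_add_distrib]
    _ ≤ ∑ j, zariskiDim (V j) := Finset.sum_le_sum fun j _ => withBot_add_one_le_of_lt (hlt j)

theorem IsZariskiClosed.ringKrullDim_le_zariskiDim_fibre [Finite τ] {E : Set (σ ⊕ τ → K)}
    (hE : IsZariskiClosed E) (y : τ → K) {B : Type*} [CommRing B] [Algebra K B]
    (π : MvPolynomial (σ ⊕ τ) K →ₐ[K] B) (hπ : Function.Surjective π)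
    (hπE : vanishingIdeal K E ≤ RingHom.ker π) (hπy : ∀ t, π (X (Sum.inr t) - C (y t)) = 0) :
    ringKrullDim B ≤ zariskiDim {a : σ → K | Sum.elim a y ∈ E} := by
  have hker : zeroLocus K (RingHom.ker π) ⊆
      (fun a => Sum.elim a y) '' {a | Sum.elim a y ∈ E} := by
    intro w hw
    have hwy : Sum.elim (w ∘ Sum.inl) y = w := by
      ext (i | t)
      · rfl
      · exact (by simpa [sub_eq_zero] using hw _ (hπy t) : w (Sum.inr t) = y t).symm
    refine ⟨w ∘ Sum.inl, ?_, hwy⟩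
    rw [Set.mem_ofPred_eq, hwy, ← hE.zeroLocus_vanishingIdeal]
    exact zeroLocus_anti_mono hπE hw
  calc ringKrullDim B
      = zariskiDim (zeroLocus K (RingHom.ker π)) := (zariskiDim_zeroLocus_ker π hπ).symm
    _ ≤ zariskiDim ((fun a => Sum.elim a y) '' {a | Sum.elim a y ∈ E}) := zariskiDim_mono hker
    _ ≤ zariskiDim {a | Sum.elim a y ∈ E} := zariskiDim_image_le (isPolynomialMap_sumElim y) _

theorem IsZariskiClosed.exists_zariskiDim_le_add_fibre [Finite τ] {E : Set (σ ⊕ τ → K)}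
    (hE : IsZariskiClosed E) (hne : E.Nonempty) {Y : Set (τ → K)}
    (hEY : Set.MapsTo (· ∘ Sum.inr) E Y) :
    ∃ y ∈ Y, zariskiDim E ≤ zariskiDim Y + zariskiDim {a : σ → K | Sum.elim a y ∈ E} := by
  algebraize [(coordinateRingMap Sum.inr hEY).toRingHom]
  have := nontrivial_coordinateRing hne
  have := finiteRingKrullDim_of_finiteType K (CoordinateRing E)
  obtain ⟨M, hM, hdim⟩ :=
    exists_isMaximal_ringKrullDim_le_add_quotient_map_under (CoordinateRing Y) (CoordinateRing E)
  obtain ⟨z, hz, rfl⟩ := hE.exists_eq_ker_evalAt M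
  refine ⟨z ∘ Sum.inr, hEY hz, hdim.trans (add_le_add_right ?_ _)⟩
  refine hE.ringKrullDim_le_zariskiDim_fibre _
    ((Ideal.Quotient.mkₐ K _).comp (Ideal.Quotient.mkₐ K (vanishingIdeal K E)))
    (Ideal.Quotient.mk_surjective.comp Ideal.Quotient.mk_surjective) (fun p hp => ?_) fun t => ?_
  · exact (congr_arg (Ideal.Quotient.mkₐ K _) (Ideal.Quotient.eq_zero_iff_mem.mpr hp)).trans
      (map_zero _)
  · refine Ideal.Quotient.eq_zero_iff_mem.mpr ?_
    have hφ : coordinateRingMap Sum.inr hEY (Ideal.Quotient.mk _ (X t - C (z (Sum.inr t)))) =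
        Ideal.Quotient.mk _ (X (Sum.inr t) - C (z (Sum.inr t))) := by
      simp
    refine hφ ▸ Ideal.mem_map_of_mem (algebraMap (CoordinateRing Y) (CoordinateRing E)) ?_
    change evalAt hz (coordinateRingMap Sum.inr hEY _) = 0
    simp

end ProductsAndFibres

/-! ### Cones -/

section Cones

-- Compare degree `n` components of `g * a - g ∈ I`: `gₙ` is congruent to `gₙ₋ᵢ * a` modulo `I`.
theorem mk_sub_one_mem_nonZeroDivisors {A S : Type*} [CommRing A] [SetLike S A]
    [AddSubgroupClass S A] (𝒜 : ℕ → S) [GradedRing 𝒜] {I : Ideal A} (hI : I.IsHomogeneous 𝒜)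
    {i : ℕ} (hi : i ≠ 0) {a : A} (ha : a ∈ 𝒜 i) :
    Ideal.Quotient.mk I (a - 1) ∈ nonZeroDivisors (A ⧸ I) := by
  refine mem_nonZeroDivisors_iff_right.mpr fun b hb => ?_
  obtain ⟨g, rfl⟩ := Ideal.Quotient.mk_surjective b
  rw [← map_mul, Ideal.Quotient.eq_zero_iff_mem, mul_sub_one] at hb
  rw [Ideal.Quotient.eq_zero_iff_mem, hI.mem_iff]
  intro n
  induction n using Nat.strong_induction_on with
  | _ n ih =>
  have hn := hI n hb
  rw [DirectSum.decompose_sub, DirectSum.sub_apply, AddSubgroupClass.coe_sub] at hn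
  refine (Submodule.sub_mem_iff_right I ?_).mp hn
  by_cases hin : i ≤ n
  · rw [DirectSum.coe_decompose_mul_of_right_mem_of_le 𝒜 ha hin]
    exact I.mul_mem_right a (ih (n - i) (by omega))
  · rw [DirectSum.coe_decompose_mul_of_right_mem_of_not_le 𝒜 ha hin]
    exact I.zero_mem

theorem eval_smul_of_isHomogeneous {R σ : Type*} [CommSemiring R] {p : MvPolynomial σ R} {n : ℕ}
    (hp : p.IsHomogeneous n) (c : R) (x : σ → R) : eval (c • x) p = c ^ n * eval x p := by
  rw [eval_eq, eval_eq, Finset.mul_sum]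
  refine Finset.sum_congr rfl fun e he => ?_
  have hdeg := hp.degree_eq_sum_deg_support he
  simp only [Pi.smul_apply, smul_eq_mul, mul_pow, Finset.prod_mul_distrib,
    Finset.prod_pow_eq_pow_sum, ← hdeg]
  ring

attribute [local instance] MvPolynomial.gradedAlgebra

theorem exists_isHomogeneous_sub_sum_mul_mem {R σ ι : Type*} [CommRing R] [Fintype ι]
    {I : Ideal (MvPolynomial σ R)} (hI : I.IsHomogeneous (homogeneousSubmodule σ R))
    {ℓ : ι → MvPolynomial σ R} (hℓ : ∀ j, (ℓ j).IsHomogeneous 1) {f : MvPolynomial σ R} {n : ℕ}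
    (hf : f.IsHomogeneous (n + 1)) (hfI : f ∈ I ⊔ Ideal.span (Set.range ℓ)) :
    ∃ c : ι → MvPolynomial σ R, (∀ j, (c j).IsHomogeneous n) ∧ f - ∑ j, c j * ℓ j ∈ I := by
  obtain ⟨g, hg, t, ht, rfl⟩ := Submodule.mem_sup.mp hfI
  obtain ⟨c, rfl⟩ := Ideal.mem_span_range_iff_exists_fun.mp ht
  let 𝒜 := homogeneousSubmodule σ R
  refine ⟨fun j => DirectSum.decompose 𝒜 (c j) n, fun j => (DirectSum.decompose 𝒜 (c j) n).2, ?_⟩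
  have hdec := DirectSum.decompose_of_mem_same 𝒜 hf
  rw [DirectSum.decompose_add, DirectSum.add_apply, Submodule.coe_add,
    DirectSum.decompose_sum, DFinsupp.finsetSum_apply, AddSubmonoidClass.coe_finsetSum,
    Finset.sum_congr rfl fun j _ =>
      DirectSum.coe_decompose_mul_add_of_right_mem 𝒜 (a := c j) (i := n) (hℓ j)] at hdec
  rw [← hdec, add_sub_cancel_right]
  exact hI (n + 1) hg

-- Graded Nakayama.
theorem eq_top_of_forall_mk_mul_mem {R σ ι : Type*} [CommRing R] [Finite ι]
    {I : Ideal (MvPolynomial σ R)} (hI : I.IsHomogeneous (homogeneousSubmodule σ R))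
    {ℓ : ι → MvPolynomial σ R} (hℓ : ∀ j, (ℓ j).IsHomogeneous 1) {k : ℕ}
    (hk : idealOfVars σ R ^ k ≤ I ⊔ Ideal.span (Set.range ℓ))
    {N : Submodule R (MvPolynomial σ R ⧸ I)}
    (hmon : ∀ e : σ →₀ ℕ, e.degree ≤ k → Ideal.Quotient.mk I (monomial e 1) ∈ N)
    (hmul : ∀ j, ∀ b ∈ N, Ideal.Quotient.mk I (ℓ j) * b ∈ N) : N = ⊤ := by
  cases nonempty_fintype ι
  have hN (n : ℕ) : ∀ f : MvPolynomial σ R, f.IsHomogeneous n → Ideal.Quotient.mk I f ∈ N := by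
    induction n using Nat.strong_induction_on with
    | _ n ih =>
    intro f hf
    rcases le_or_gt n k with hn | hn
    · rw [f.as_sum, map_sum]
      refine N.sum_mem fun e he => ?_
      rw [← mul_one (coeff e f), ← smul_eq_mul, ← smul_monomial]
      exact N.smul_mem _ (hmon e ((hf.degree_eq_sum_deg_support he).symm.trans_le hn))
    · obtain ⟨r, rfl⟩ := Nat.exists_eq_add_one_of_ne_zero (Nat.ne_zero_of_lt hn)
      have hfk : f ∈ idealOfVars σ R ^ k := (mem_pow_idealOfVars_iff' k f).mpr fun e he =>
        hf.coeff_eq_zero (by omega)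
      obtain ⟨c, hc, hfc⟩ := exists_isHomogeneous_sub_sum_mul_mem hI hℓ hf (hk hfk)
      rw [Ideal.Quotient.eq.mpr hfc, map_sum]
      refine N.sum_mem fun j _ => ?_
      rw [mul_comm, map_mul]
      exact hmul j _ (ih r (by omega) _ (hc j))
  refine eq_top_iff.mpr fun b _ => ?_
  obtain ⟨f, rfl⟩ := Ideal.Quotient.mk_surjective b
  rw [← sum_homogeneousComponent f, map_sum]
  exact N.sum_mem fun n _ => hN n _ (homogeneousComponent_isHomogeneous n f)

theorem finite_aeval_mk_of_idealOfVars_pow_le {R σ ι : Type*} [CommRing R] [Finite σ] [Finite ι]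
    {I : Ideal (MvPolynomial σ R)} (hI : I.IsHomogeneous (homogeneousSubmodule σ R))
    {ℓ : ι → MvPolynomial σ R} (hℓ : ∀ j, (ℓ j).IsHomogeneous 1) {k : ℕ}
    (hk : idealOfVars σ R ^ k ≤ I ⊔ Ideal.span (Set.range ℓ)) :
    (aeval fun j => Ideal.Quotient.mk I (ℓ j) : MvPolynomial ι R →ₐ[R] _).Finite := by
  let φ : MvPolynomial ι R →ₐ[R] MvPolynomial σ R ⧸ I := aeval fun j => Ideal.Quotient.mk I (ℓ j)
  algebraize [φ.toRingHom]
  have : IsScalarTower R (MvPolynomial ι R) (MvPolynomial σ R ⧸ I) := .of_algHom φ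
  let M : Submodule (MvPolynomial ι R) (MvPolynomial σ R ⧸ I) := Submodule.span _
    ((fun e : σ →₀ ℕ => Ideal.Quotient.mk I (monomial e 1)) '' {e | e.degree ≤ k})
  have hmul (j : ι) (b : MvPolynomial σ R ⧸ I) (hb : b ∈ M) :
      Ideal.Quotient.mk I (ℓ j) * b ∈ M := by
    have hX : φ (X j) = Ideal.Quotient.mk I (ℓ j) := aeval_X _ j
    rw [← hX]
    exact M.smul_mem (X j) hb
  have htop : M.restrictScalars R = ⊤ := eq_top_of_forall_mk_mul_mem hI hℓ hk
    (fun e he => Submodule.subset_span ⟨e, he, rfl⟩) hmul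
  have hfin : Module.Finite (MvPolynomial ι R) (MvPolynomial σ R ⧸ I) :=
    ⟨(Submodule.restrictScalars_eq_top_iff _ _ _).mp htop ▸
      Submodule.fg_span ((Finsupp.finite_of_degree_le k).image _)⟩
  exact hfin

variable {K σ ι : Type*} [Field K]

/-- Zariski closed cones: common zeros of an arbitrary set of homogeneous polynomials, possibly of
different degrees. A nonzero constant is allowed, so the empty set is a cone. -/
def IsZariskiClosedCone (W : Set (σ → K)) : Prop :=
  ∃ S : Set (MvPolynomial σ K), (∀ p ∈ S, ∃ n, p.IsHomogeneous n) ∧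
    W = {x | ∀ p ∈ S, eval x p = 0}

namespace IsZariskiClosedCone

variable {W : Set (σ → K)}

theorem smul_mem (hW : IsZariskiClosedCone W) {x : σ → K} (hx : x ∈ W) (c : K) :
    c • x ∈ W := by
  obtain ⟨S, hS, rfl⟩ := hW
  intro p hp
  obtain ⟨n, hn⟩ := hS p hp
  rw [eval_smul_of_isHomogeneous hn, hx p hp, mul_zero]

theorem isZariskiClosed (hW : IsZariskiClosedCone W) : IsZariskiClosed W :=
  hW.imp fun _ hS => hS.2

theorem exists_isHomogeneous_zeroLocus_eq (hW : IsZariskiClosedCone W) :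
    ∃ I : Ideal (MvPolynomial σ K), I.IsHomogeneous (homogeneousSubmodule σ K) ∧
      zeroLocus K I = W := by
  obtain ⟨S, hS, rfl⟩ := hW
  exact ⟨Ideal.span S, Ideal.homogeneous_span _ _ hS, zeroLocus_span _⟩

variable [IsAlgClosed K] [Finite σ]

theorem zariskiDim_inter_coord_eq_one_add_one_le (hW : IsZariskiClosedCone W) (i : σ) :
    zariskiDim (W ∩ {x | x i = 1}) + 1 ≤ zariskiDim W := by
  obtain ⟨I, hI, rfl⟩ := hW.exists_isHomogeneous_zeroLocus_eq
  have hle : I ≤ vanishingIdeal K (zeroLocus K I ∩ {x | x i = 1}) :=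
    (le_vanishingIdeal_zeroLocus I).trans (vanishingIdeal_anti_mono Set.inter_subset_left)
  rw [zariskiDim_zeroLocus]
  refine ringKrullDim_succ_le_of_surjective _ (Ideal.Quotient.factor_surjective hle)
    (mk_sub_one_mem_nonZeroDivisors _ hI one_ne_zero (isHomogeneous_X K i)) ?_
  rw [Ideal.Quotient.factor_mk, Ideal.Quotient.eq_zero_iff_mem]
  rintro x ⟨-, hx⟩
  simp [hx.out]

theorem zariskiDim_le_card (hW : IsZariskiClosedCone W) [Fintype ι]
    (ℓ : (σ → K) →ₗ[K] ι → K) (h : ∀ x ∈ W, ℓ x = 0 → x = 0) :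
    zariskiDim W ≤ Fintype.card ι := by
  classical
  cases nonempty_fintype σ
  obtain ⟨I, hI, rfl⟩ := hW.exists_isHomogeneous_zeroLocus_eq
  let f := ℓ.toMvPolynomial (Pi.basisFun K σ) (Pi.basisFun K ι)
  have hf (x : σ → K) (j : ι) : eval x (f j) = ℓ x j :=
    (Matrix.toMvPolynomial_eval_eq_apply _ j x).trans <|
      congrFun (ℓ.toMatrix_mulVec_repr (Pi.basisFun K σ) (Pi.basisFun K ι) x) j
  have hrad : idealOfVars σ K ≤ (I ⊔ Ideal.span (Set.range f)).radical := by
    rw [← vanishingIdeal_zeroLocus_eq_radical (K := K), idealOfVars, Ideal.span_le]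
    rintro _ ⟨i, rfl⟩ x hx
    have hx0 : x = 0 := h x (zeroLocus_anti_mono le_sup_left hx) <| funext fun j => by
      rw [← hf, ← aeval_eq_eval]
      exact hx (f j) (Ideal.mem_sup_right (Ideal.subset_span ⟨j, rfl⟩))
    simp [hx0]
  obtain ⟨k, hk⟩ := Ideal.exists_pow_le_of_le_radical_of_fg hrad (idealOfVars_fg σ K)
  have hfin := finite_aeval_mk_of_idealOfVars_pow_le hI
    (ℓ.toMvPolynomial_isHomogeneous (Pi.basisFun K σ) (Pi.basisFun K ι)) hk
  calc zariskiDim (zeroLocus K I)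
      = ringKrullDim (MvPolynomial σ K ⧸ I) := zariskiDim_zeroLocus I
    _ ≤ ringKrullDim (MvPolynomial ι K) :=
        ringKrullDim_le_of_isIntegral _ (RingHom.Finite.to_isIntegral hfin)
    _ = Fintype.card ι := by rw [ringKrullDim_mvPolynomial_eq_card, Nat.card_eq_fintype_card]

end IsZariskiClosedCone

end Cones

/-! ### The incidence variety -/

section Incidence

variable {K σ τ ι : Type*} [Field K] (L : (σ → K) →ₗ[K] (τ → K) →ₗ[K] K)

/-- The linear map `x ↦ (L(a_j, x))_j` given by sampling against the rows `a_j` of `A`. -/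
def sampleMap (A : ι × σ → K) : (τ → K) →ₗ[K] ι → K :=
  LinearMap.pi fun j => L (A ∘ Prod.mk j)

theorem sampleMap_eq_zero_iff (A : ι × σ → K) (x : τ → K) :
    sampleMap L A x = 0 ↔ ∀ j, L (A ∘ Prod.mk j) x = 0 :=
  funext_iff

/-- The pairs `(A, x)` with `A` in the product of the `V j` and `x ∈ Y` such that all samples of `x`
against the rows of `A` vanish. -/
def incidenceSet (V : ι → Set (σ → K)) (Y : Set (τ → K)) : Set ((ι × σ) ⊕ τ → K) :=
  {z | z ∘ Sum.inl ∈ affineProduct V ∧ z ∘ Sum.inr ∈ Y ∧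
    sampleMap L (z ∘ Sum.inl) (z ∘ Sum.inr) = 0}

theorem setOf_sumElim_mem_incidenceSet (V : ι → Set (σ → K)) {Y : Set (τ → K)} {y : τ → K}
    (hy : y ∈ Y) :
    {A | Sum.elim A y ∈ incidenceSet L V Y} = affineProduct fun j => V j ∩ {a | L a y = 0} := by
  ext A
  simp [incidenceSet, affineProduct, sampleMap_eq_zero_iff, hy, forall_and]

/-- The `A` in the product of the `V j` for which the samples fail to detect some nonzero point of
`W`. -/
def degenerateSamples (V : ι → Set (σ → K)) (W : Set (τ → K)) : Set (ι × σ → K) :=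
  {A ∈ affineProduct V | ∃ x ∈ W, x ≠ 0 ∧ sampleMap L A x = 0}

theorem degenerateSamples_eq_iUnion (V : ι → Set (σ → K)) {W : Set (τ → K)}
    (hW : IsZariskiClosedCone W) :
    degenerateSamples L V W = ⋃ i, (· ∘ Sum.inl) '' incidenceSet L V (W ∩ {x | x i = 1}) := by
  ext A
  rw [Set.mem_iUnion]
  constructor
  · rintro ⟨hA, x, hx, hx0, hAx⟩
    obtain ⟨i, hi⟩ := Function.ne_iff.mp hx0
    refine ⟨i, Sum.elim A ((x i)⁻¹ • x), ⟨hA, ⟨hW.smul_mem hx _, inv_mul_cancel₀ hi⟩, ?_⟩, rfl⟩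
    simp [hAx]
  · rintro ⟨i, z, ⟨hzV, ⟨hzW, hzi⟩, hz⟩, rfl⟩
    exact ⟨hzV, z ∘ Sum.inr, hzW, fun h0 => by simp [h0] at hzi, hz⟩

variable [Finite σ] [Finite τ]

theorem isZariskiClosed_setOf_bilinear_eq_zero (e : σ → ι) (f : τ → ι) :
    IsZariskiClosed {z : ι → K | L (z ∘ e) (z ∘ f) = 0} := by
  classical
  cases nonempty_fintype σ
  cases nonempty_fintype τ
  convert isZariskiClosed_setOf_eval_eq_zero
    (∑ a, ∑ b, X (e a) * (X (f b) * C (L (Pi.single a 1) (Pi.single b 1)))) with z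
  have hL := LinearMap.sum_repr_mul_repr_mul (Pi.basisFun K σ) (Pi.basisFun K τ)
    (B := L) (z ∘ e) (z ∘ f)
  simpa [Finsupp.sum_fintype] using hL.symm

theorem isZariskiClosed_incidenceSet {V : ι → Set (σ → K)} (hV : ∀ j, IsZariskiClosed (V j))
    {Y : Set (τ → K)} (hY : IsZariskiClosed Y) : IsZariskiClosed (incidenceSet L V Y) := by
  simp only [incidenceSet, sampleMap_eq_zero_iff, Set.ofPred_and, Set.ofPred_forall]
  exact ((isZariskiClosed_affineProduct hV).preimage (isPolynomialMap_comp_right Sum.inl)).inter <|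
    (hY.preimage (isPolynomialMap_comp_right Sum.inr)).inter <| .iInter fun j =>
      isZariskiClosed_setOf_bilinear_eq_zero L (fun i => Sum.inl (j, i)) Sum.inr

variable [IsAlgClosed K] [Fintype ι]

theorem zariskiDim_incidenceSet_add_card_le {V : ι → Set (σ → K)}
    (hV : ∀ j, IsZariskiClosed (V j)) {Y : Set (τ → K)} (hY : IsZariskiClosed Y)
    (hadm : ∀ j, ∀ y ∈ Y, zariskiDim (V j ∩ {a | L a y = 0}) < zariskiDim (V j)) :
    zariskiDim (incidenceSet L V Y) + Fintype.card ι ≤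
      zariskiDim Y + zariskiDim (affineProduct V) := by
  rcases (incidenceSet L V Y).eq_empty_or_nonempty with hempty | hne
  · simp [hempty]
  obtain ⟨y, hy, hdim⟩ := (isZariskiClosed_incidenceSet L hV hY).exists_zariskiDim_le_add_fibre hne
    (Y := Y) fun z hz => hz.2.1
  rw [setOf_sumElim_mem_incidenceSet L V hy] at hdim
  have hclosed (j : ι) : IsZariskiClosed (V j ∩ {a | L a y = 0}) :=
    (hV j).inter <|
      (isZariskiClosed_setOf_bilinear_eq_zero L Sum.inl Sum.inr).preimage
        (isPolynomialMap_sumElim y)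
  calc zariskiDim (incidenceSet L V Y) + Fintype.card ι
      ≤ zariskiDim Y + zariskiDim (affineProduct fun j => V j ∩ {a | L a y = 0}) +
          Fintype.card ι := by gcongr
    _ ≤ zariskiDim Y + zariskiDim (affineProduct V) := by
        rw [add_assoc]
        gcongr
        exact zariskiDim_affineProduct_add_card_le hV hclosed fun j => hadm j y hy

theorem zariskiDim_degenerateSamples_add_le {V : ι → Set (σ → K)}
    (hV : ∀ j, IsZariskiClosed (V j)) {W : Set (τ → K)} (hW : IsZariskiClosedCone W)
    (hadm : ∀ j, ∀ x ∈ W, x ≠ 0 → zariskiDim (V j ∩ {a | L a x = 0}) < zariskiDim (V j)) :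
    zariskiDim (degenerateSamples L V W) + (Fintype.card ι + 1 : ℕ) ≤
      zariskiDim (affineProduct V) + zariskiDim W := by
  rw [degenerateSamples_eq_iUnion L V hW]
  refine zariskiDim_iUnion_add_le fun i => ?_
  set Y := W ∩ {x | x i = 1}
  have hY : IsZariskiClosed Y := hW.isZariskiClosed.inter (isZariskiClosed_setOf_coord_eq i 1)
  have hne (y : τ → K) (hy : y ∈ Y) : y ≠ 0 := by
    rintro rfl
    simpa using hy.2.out
  calc zariskiDim ((· ∘ Sum.inl) '' incidenceSet L V Y) + (Fintype.card ι + 1 : ℕ)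
      ≤ zariskiDim (incidenceSet L V Y) + (Fintype.card ι + 1 : ℕ) := by
        gcongr
        exact zariskiDim_image_le (isPolynomialMap_comp_right Sum.inl) _
    _ = zariskiDim (incidenceSet L V Y) + Fintype.card ι + 1 := by
        rw [Nat.cast_add_one, add_assoc]
    _ ≤ zariskiDim Y + zariskiDim (affineProduct V) + 1 :=
        add_le_add (zariskiDim_incidenceSet_add_card_le L hV hY fun j y hy =>
          hadm j y hy.1 (hne y hy)) le_rfl
    _ = zariskiDim (affineProduct V) + (zariskiDim Y + 1) := by
        rw [add_comm (zariskiDim Y), add_assoc]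
    _ ≤ zariskiDim (affineProduct V) + zariskiDim W := by
        gcongr
        exact hW.zariskiDim_inter_coord_eq_one_add_one_le i

theorem not_affineProduct_subset_degenerateSamples {V : ι → Set (σ → K)}
    (hV : ∀ j, IsZariskiClosed (V j)) {W : Set (τ → K)} (hW : IsZariskiClosedCone W)
    (hadm : ∀ j, ∀ x ∈ W, x ≠ 0 → zariskiDim (V j ∩ {a | L a x = 0}) < zariskiDim (V j))
    (hne : (affineProduct V).Nonempty) (hle : zariskiDim W ≤ Fintype.card ι) :
    ¬ affineProduct V ⊆ degenerateSamples L V W := by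
  intro hsub
  obtain ⟨N, hN⟩ := exists_zariskiDim_eq_natCast hne
  have h : zariskiDim (affineProduct V) + (Fintype.card ι + 1 : ℕ) ≤
      zariskiDim (affineProduct V) + Fintype.card ι :=
    calc zariskiDim (affineProduct V) + (Fintype.card ι + 1 : ℕ)
        ≤ zariskiDim (degenerateSamples L V W) + (Fintype.card ι + 1 : ℕ) := by
          gcongr
          exact zariskiDim_mono hsub
      _ ≤ zariskiDim (affineProduct V) + zariskiDim W :=
          zariskiDim_degenerateSamples_add_le L hV hW hadm
      _ ≤ zariskiDim (affineProduct V) + Fintype.card ι := by gcongr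
  rw [hN] at h
  norm_cast at h
  omega

theorem exists_isZariskiClosed_forall_sampleMap_eq_zero {V : ι → Set (σ → K)}
    (hV : ∀ j, IsZariskiClosed (V j)) {W : Set (τ → K)} (hW : IsZariskiClosedCone W)
    (hadm : ∀ j, ∀ x ∈ W, x ≠ 0 → zariskiDim (V j ∩ {a | L a x = 0}) < zariskiDim (V j)) :
    ∃ Z, IsZariskiClosed Z ∧ Z ⊆ affineProduct V ∧
      zariskiDim Z + (Fintype.card ι + 1 : ℕ) ≤ zariskiDim (affineProduct V) + zariskiDim W ∧
      ∀ A ∈ affineProduct V \ Z, ∀ x ∈ W, sampleMap L A x = 0 → x = 0 := by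
  refine ⟨zeroLocus K (vanishingIdeal K (degenerateSamples L V W)),
    isZariskiClosed_zeroLocus _, ?_, ?_, ?_⟩
  · rw [← (isZariskiClosed_affineProduct hV).zeroLocus_vanishingIdeal]
    exact zeroLocus_anti_mono (vanishingIdeal_anti_mono fun A hA => hA.1)
  · rw [zariskiDim_zeroLocus_vanishingIdeal]
    exact zariskiDim_degenerateSamples_add_le L hV hW hadm
  · rintro A ⟨hA, hAZ⟩ x hx hAx
    by_contra hx0
    exact hAZ (zeroLocus_vanishingIdeal_le _ ⟨hA, x, hx, hx0, hAx⟩)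

end Incidence

theorem mainTheorem1_general {K σ τ ι : Type*} [Field K] [IsAlgClosed K] [Finite σ] [Finite τ]
    [Fintype ι] (L : (σ → K) →ₗ[K] (τ → K) →ₗ[K] K)
    {W : Set (τ → K)} (hW : IsZariskiClosedCone W)
    {V : ι → Set (σ → K)} (hV : ∀ j, IsZariskiClosed (V j))
    (hadm : ∀ j, ∀ x ∈ W, x ≠ 0 → zariskiDim (V j ∩ {a | L a x = 0}) < zariskiDim (V j)) :
    (∃ Z, IsZariskiClosed Z ∧ Z ⊆ affineProduct V ∧
      zariskiDim Z + (Fintype.card ι + 1 : ℕ) ≤ zariskiDim (affineProduct V) + zariskiDim W ∧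
      ∀ A ∈ affineProduct V \ Z, ∀ x ∈ W, sampleMap L A x = 0 → x = 0) ∧
    (Fintype.card ι < zariskiDim W →
      ∀ A : ι × σ → K, ∃ x₀ ∈ W, x₀ ≠ 0 ∧ sampleMap L A x₀ = 0) ∧
    ((affineProduct V).Nonempty →
      ((∃ A ∈ affineProduct V, ∀ x ∈ W, sampleMap L A x = 0 → x = 0) ↔
        zariskiDim W ≤ Fintype.card ι)) := by
  refine ⟨exists_isZariskiClosed_forall_sampleMap_eq_zero L hV hW hadm, fun hlt A => ?_,
    fun hne => ⟨?_, fun hle => ?_⟩⟩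
  · contrapose! hlt
    exact hW.zariskiDim_le_card (sampleMap L A) fun x hx hAx => by_contra fun h => hlt x hx h hAx
  · rintro ⟨A, -, hA⟩
    exact hW.zariskiDim_le_card (sampleMap L A) hA
  · obtain ⟨A, hA, hAdeg⟩ := Set.not_subset.mp
      (not_affineProduct_subset_degenerateSamples L hV hW hadm hne hle)
    exact ⟨A, hA, fun x hx hAx => by_contra fun hx0 => hAdeg ⟨hA, x, hx, hx0, hAx⟩⟩

section ComplexVarieties

variable {σ : Type*}

theorem isAlgebraicVariety_iff_isZariskiClosed [Finite σ] {V : Set (σ → ℂ)} :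
    IsAlgebraicVariety V ↔ IsZariskiClosed V := by
  refine ⟨fun ⟨S, hS⟩ => ⟨S, hS⟩, fun hV => ?_⟩
  obtain ⟨S, hS⟩ := (vanishingIdeal ℂ V).fg_of_isNoetherianRing
  refine ⟨S, ?_⟩
  rw [← hV.zeroLocus_vanishingIdeal, ← hS]
  exact zeroLocus_span _

theorem IsHomogeneousVariety.isZariskiClosedCone {W : Set (σ → ℂ)} (hW : IsHomogeneousVariety W) :
    IsZariskiClosedCone W :=
  let ⟨S, hS⟩ := hW
  ⟨S, hS⟩

end ComplexVarieties

theorem mainTheorem1 {m d : ℕ}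
    (L : (Fin d → ℂ) →ₗ[ℂ] (Fin d → ℂ) →ₗ[ℂ] ℂ)
    (W : Set (Fin d → ℂ)) (hW : IsHomogeneousVariety W)
    (V : Fin m → Set (Fin d → ℂ)) (hV : ∀ j, IsAlgebraicVariety (V j))
    (hadm : ∀ j, IsAdmissible (V j) {l | ∃ x ∈ W \ {0}, l = L.flip x}) :
    -- (i), where `dim Z ≤ dim V - (m - dim W + 1)` is written without subtraction
    (varietyDim W ≤ (m : WithBot ℕ∞) →
      ∃ Z : Set (Fin m × Fin d → ℂ), IsAlgebraicVariety Z ∧ Z ⊆ productVariety V ∧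
        varietyDim Z + ((m + 1 : ℕ) : WithBot ℕ∞) ≤
          varietyDim (productVariety V) + varietyDim W ∧
        ∀ A ∈ productVariety V \ Z, ∀ x ∈ W, linearSamples L A x = 0 → x = 0) ∧
    -- (ii)
    ((m : WithBot ℕ∞) < varietyDim W →
      ∀ A ∈ productVariety V, ∃ x₀ ∈ W, x₀ ≠ 0 ∧ linearSamples L A x₀ = 0) ∧
    -- `m` measurements can suffice exactly when `m ≥ dim W`
    ((productVariety V).Nonempty →
      ((∃ A ∈ productVariety V, ∀ x ∈ W, linearSamples L A x = 0 → x = 0) ↔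
        varietyDim W ≤ (m : WithBot ℕ∞))) := by
  have hmain := mainTheorem1_general L hW.isZariskiClosedCone
    (fun j => isAlgebraicVariety_iff_isZariskiClosed.mp (hV j))
    fun j x hx hx0 => hadm j (L.flip x) ⟨x, ⟨hx, hx0⟩, rfl⟩
  rw [Fintype.card_fin] at hmain
  obtain ⟨⟨Z, hZ, hZV⟩, hexists, hiff⟩ := hmain
  exact ⟨fun _ => ⟨Z, isAlgebraicVariety_iff_isZariskiClosed.mpr hZ, hZV⟩,
    fun hlt A _ => hexists hlt A, hiff⟩
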